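/- **Proposition 4.3.** Let $p$ be a prime number. Products of maps are read from left to right, so $(fg)(i)=g(f(i))$, and automorphisms are written on the right of their arguments. Let $\lambda_\infty$ and $\mu_\infty$ be the bijections of $\mathbb{Z}$ defined by $$\lambda_\infty(i)=i+1,\qquad \mu_\infty(i)=\begin{cases} i+1, & i\not\equiv p-1 \pmod p,\\ i-(p-1), & i\equiv p-1 \pmod p.\end{cases}$$ For each $i\in\mathbb{Z}$ let $C_i$ be a cyclic group of order $p$ with a generator $c_i$. Let $H_\infty$ be the direct product (with finite supports, i.e. the direct sum) of the groups $C_i$ ($i\in\mathbb{Z}$), and let $\alpha_\infty$ and $\beta_\infty$ be the automorphisms of $H_\infty$ given by $$c_i\alpha_\infty=c_{\mu_\infty(i)},\qquad c_i\beta_\infty=c_{(\lambda_\infty^{-1}\mu_\infty\lambda_\infty)(i)}\qquad(i\in\mathbb{Z}).$$ Let $A_\infty$ and $B_\infty$ be the split extensions (semidirect products) of $H_\infty$ by the cyclic groups $\langle\alpha_\infty\rangle,\langle\beta_\infty\rangle\le\operatorname{Aut}H_\infty$, respectively. Then the following statements hold. 1. The generalized free product $P_\infty$ of the groups $A_\infty$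 and $B_\infty$ with the amalgamated subgroup $H_\infty$ is residually $p$-finite: for every $x\in P_\infty\setminus\{1\}$ there is a homomorphism $\sigma$ of $P_\infty$ onto a finite $p$-group such that $x\sigma\neq 1$. 2. The automorphism $\alpha_\infty^{-1}\beta_\infty$ has infinite order. -/

import Mathlib

namespace AmalgP

/-- A group `G` is residually `p`-finite: every `x ≠ 1` has a non-trivial image under some
homomorphism of `G` onto a finite `p`-group. (The codomain may be taken in the universe of `G`,
since it is isomorphic to a quotient of `G`.) -/
def IsResiduallyPFinite.{u} (p : ℕ) (G : Type u) [Group G] : Prop :=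
  ∀ x : G, x ≠ 1 → ∃ (Q : Type u) (_ : Group Q) (σ : G →* Q),
    Finite Q ∧ IsPGroup p Q ∧ Function.Surjective σ ∧ σ x ≠ 1

/-- The shift `i ↦ i + 1` of `ℤ`. -/
def lam : Equiv.Perm ℤ := Equiv.addRight 1

/-- The bijection of `ℤ` that rotates each block `{kp, kp + 1, …, kp + p - 1}`. -/
def mu (p : ℕ) : Equiv.Perm ℤ where
  toFun i := if i ≡ (p : ℤ) - 1 [ZMOD p] then i - ((p : ℤ) - 1) else i + 1
  invFun i := if i ≡ 0 [ZMOD p] then i + ((p : ℤ) - 1) else i - 1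
  left_inv i := by
    dsimp only
    by_cases h : i ≡ (p : ℤ) - 1 [ZMOD p]
    · have h' : i - ((p : ℤ) - 1) ≡ 0 [ZMOD p] := by
        simpa using h.sub_right ((p : ℤ) - 1)
      rw [if_pos h, if_pos h']; ring
    · have h' : ¬ i + 1 ≡ 0 [ZMOD p] := fun h0 => h <| by
        have h1 : i ≡ 0 - 1 [ZMOD p] := by simpa using h0.sub_right 1
        exact h1.trans (by simp [Int.modEq_iff_dvd])
      rw [if_neg h, if_neg h']; ring
  right_inv i := by
    dsimp only
    by_cases h : i ≡ 0 [ZMOD p]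
    · have h' : i + ((p : ℤ) - 1) ≡ (p : ℤ) - 1 [ZMOD p] := by
        simpa using h.add_right ((p : ℤ) - 1)
      rw [if_pos h, if_pos h']; ring
    · have h' : ¬ i - 1 ≡ (p : ℤ) - 1 [ZMOD p] := fun h0 => h <| by
        have h1 : i ≡ p [ZMOD p] := by simpa using h0.add_right 1
        exact h1.trans (by simp [Int.modEq_iff_dvd])
      rw [if_neg h, if_neg h']; ring

/-- The product `λ⁻¹ μ λ`, the factors being applied from left to right. -/
def nu (p : ℕ) : Equiv.Perm ℤ := (lam.symm.trans (mu p)).trans lam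

/-- The direct product (with finite supports) of cyclic groups of order `p` indexed by `ℤ`,
written multiplicatively. -/
abbrev H (p : ℕ) : Type := Multiplicative (ℤ →₀ ZMod p)

/-- The chosen generator `c i` of the `i`-th cyclic factor. -/
noncomputable def c (p : ℕ) (i : ℤ) : H p := Multiplicative.ofAdd (Finsupp.single i 1)

/-- The automorphism of `H p` that permutes the factors according to `π`. -/
noncomputable def permAut (p : ℕ) (π : Equiv.Perm ℤ) : MulAut (H p) :=
  AddEquiv.toMultiplicative (Finsupp.domCongr π)

theorem permAut_c (p : ℕ) (π : Equiv.Perm ℤ) (i : ℤ) : permAut p π (c p i) = c p (π i) := by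
  simp [permAut, c]

/-- The automorphism `c i ↦ c (μ i)`. -/
noncomputable def alpha (p : ℕ) : MulAut (H p) := permAut p (mu p)

/-- The automorphism `c i ↦ c ((λ⁻¹ μ λ) i)`. -/
noncomputable def beta (p : ℕ) : MulAut (H p) := permAut p (nu p)

/-- The split extension of a group `N` by the cyclic group generated by an automorphism `γ`
of `N`. -/
abbrev SplitExt {N : Type*} [Group N] (γ : MulAut N) : Type _ :=
  N ⋊[(Subgroup.zpowers γ).subtype] (Subgroup.zpowers γ)

/-- The two automorphisms as a family: `false` gives `alpha p` and `true` gives `beta p`. -/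
noncomputable def autFamily (p : ℕ) : Bool → MulAut (H p)
  | false => alpha p
  | true => beta p

/-- The generalized free product of `SplitExt (alpha p)` and `SplitExt (beta p)` with `H p`
amalgamated: the pushout of the two canonical embeddings of `H p`. -/
abbrev P (p : ℕ) : Type :=
  Monoid.PushoutI (fun b : Bool => (SemidirectProduct.inl : H p →* SplitExt (autFamily p b)))

end AmalgP

/-!
`P p` is the split extension of `H p` by the free product `F` of two groups of order `p`, which acts
on `H p` by permuting the factors.

The group `F` is residually `p`-finite: send the elements of the `m`-th syllable's factor to
unitriangular matrices over `ZMod p` having a nontrivial character of that factor at the `m`-th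
place of the superdiagonal. The image of a reduced word then has the product of the characters of
its syllables in the corner.

An element of `H p` is detected modulo `p ^ n`. The permutations `λ` and `μ` act on the tree of
residue classes modulo the powers of `p` by rotating the children of each vertex, so `F` acts on
`ZMod (p ^ n)` through a finite `p`-group, and for large `n` the classes modulo `p ^ n` of the
support of the given element are distinct.

Finally, `ν μ⁻¹` moves every multiple `i` of `p` to `i + p`, hence has infinite order.
-/

namespace AmalgP

open Monoid

section ResidualFiniteness

theorem exists_surjective_ne_one_of_hom.{u, v} {p : ℕ} {G : Type u} {K : Type v} [Group G]
    [Group K] [Finite K] (hK : IsPGroup p K) (f : G →* K) {x : G} (hx : f x ≠ 1) :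
    ∃ (Q : Type u) (_ : Group Q) (σ : G →* Q),
      Finite Q ∧ IsPGroup p Q ∧ Function.Surjective σ ∧ σ x ≠ 1 := by
  have embedding_injective := QuotientGroup.kerLift_injective f
  exact ⟨G ⧸ f.ker, inferInstance, QuotientGroup.mk' f.ker,
    Finite.of_injective _ embedding_injective, hK.of_injective _ embedding_injective,
    QuotientGroup.mk'_surjective _, mt (QuotientGroup.eq_one_iff x).1 hx⟩

theorem IsResiduallyPFinite.of_injective.{u, v} {p : ℕ} {G : Type u} {K : Type v} [Group G]
    [Group K] (hK : IsResiduallyPFinite p K) {f : G →* K} (hf : Function.Injective f) :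
    IsResiduallyPFinite p G := fun x hx => by
  obtain ⟨Q, _, σ, hQ, hQp, -, hσ⟩ := hK (f x) ((map_ne_one_iff f hf).2 hx)
  exact exists_surjective_ne_one_of_hom hQp (σ.comp f) hσ

theorem IsResiduallyPFinite.semidirectProduct.{u} {p : ℕ} {N G : Type*} [Group N] [Group G]
    {φ : G →* MulAut N} (hG : IsResiduallyPFinite p G)
    (hN : ∀ x : N, x ≠ 1 → ∃ (Q : Type u) (_ : Group Q) (σ : N ⋊[φ] G →* Q),
      Finite Q ∧ IsPGroup p Q ∧ σ (SemidirectProduct.inl x) ≠ 1) :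
    IsResiduallyPFinite p (N ⋊[φ] G) := by
  intro z hz
  by_cases hright : z.right = 1
  · have hz_inl : z = SemidirectProduct.inl z.left := by ext <;> simp [hright]
    have hleft : z.left ≠ 1 := fun h => hz (by rw [hz_inl, h, map_one])
    obtain ⟨Q, _, σ, hQ, hQp, hσ⟩ := hN z.left hleft
    exact exists_surjective_ne_one_of_hom hQp σ (by rwa [hz_inl])
  · obtain ⟨Q, _, σ, hQ, hQp, -, hσ⟩ := hG z.right hright
    exact exists_surjective_ne_one_of_hom hQp (σ.comp SemidirectProduct.rightHom) hσ

theorem isPGroup_semidirectProduct {p : ℕ} {N G : Type*} [Group N] [Group G]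
    {φ : G →* MulAut N} (hN : IsPGroup p N) (hG : IsPGroup p G) : IsPGroup p (N ⋊[φ] G) := by
  intro z
  obtain ⟨k, hk⟩ := hG z.right
  have hker : z ^ p ^ k ∈ (SemidirectProduct.inl : N →* N ⋊[φ] G).range := by
    rw [SemidirectProduct.range_inl_eq_ker_rightHom, MonoidHom.mem_ker, map_pow]
    exact hk
  obtain ⟨x, hx⟩ := hker
  obtain ⟨l, hl⟩ := hN x
  exact ⟨k + l, by rw [pow_add, pow_mul, ← hx, ← map_pow, hl, map_one]⟩

end ResidualFiniteness

section UnitriangularMatrices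

variable {ι R : Type*} [Fintype ι] [LinearOrder ι] [CommRing R]

/-- The upper unitriangular matrices. As a submonoid, they are a target for homomorphisms from
groups that needs no inverse matrices; such homomorphisms land in the group of units. -/
def unitriangular (ι R : Type*) [Fintype ι] [LinearOrder ι] [CommRing R] :
    Submonoid (Matrix ι ι R) where
  carrier := {M | M.IsUpperTriangular ∧ ∀ i, M i i = 1}
  one_mem' := ⟨Matrix.blockTriangular_one, Matrix.one_apply_eq⟩
  mul_mem' {M N} hM hN := by
    refine ⟨hM.1.mul hN.1, fun i => ?_⟩
    rw [Matrix.mul_apply, Finset.sum_eq_single i, hM.2, hN.2, one_mul]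
    · intro j _ hj
      rcases hj.lt_or_gt with h | h
      · rw [hM.1 h, zero_mul]
      · rw [hN.1 h, mul_zero]
    · simp

theorem sub_one_pow_card_eq_zero_of_mem_unitriangular {M : Matrix ι ι R}
    (hM : M ∈ unitriangular ι R) :
    (M - 1) ^ Fintype.card ι = 0 := by
  simpa [Matrix.charpoly_of_isUpperTriangular M hM.1, hM.2] using M.aeval_self_charpoly

theorem isPGroup_units_unitriangular (p : ℕ) [Fact p.Prime] [CharP R p] [Nonempty ι] :
    IsPGroup p (unitriangular ι R)ˣ := by
  intro u
  set n := Fintype.card ι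
  have hnil : (u.1.1 - 1) ^ p ^ n = 0 :=
    pow_eq_zero_of_le (Nat.lt_pow_self (Fact.out : p.Prime).one_lt).le
      (sub_one_pow_card_eq_zero_of_mem_unitriangular u.1.2)
  rw [sub_pow_char_pow_of_commute _ _ (Commute.one_right _), one_pow, sub_eq_zero] at hnil
  exact ⟨n, Units.ext (Subtype.ext hnil)⟩

end UnitriangularMatrices

section Superdiagonal

variable {R : Type*} [CommRing R] {n : ℕ}

/-- The matrix with the entries `a 0, …, a (n - 2)` on the superdiagonal and zeros elsewhere.
Indexing the entries by `ℕ` avoids casts between the types `Fin n`. -/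
def superdiagonal (n : ℕ) (a : ℕ → R) : Matrix (Fin n) (Fin n) R :=
  Matrix.of fun i j => if (j : ℕ) = i + 1 then a i else 0

theorem superdiagonal_add (a b : ℕ → R) :
    superdiagonal n (a + b) = superdiagonal n a + superdiagonal n b := by
  ext i j
  simp [superdiagonal, ite_add_ite]

theorem superdiagonal_mul_apply (a : ℕ → R) (M : Matrix (Fin n) (Fin n) R) {i i' : Fin n}
    (hi : (i' : ℕ) = i + 1) (j : Fin n) : (superdiagonal n a * M) i j = a i * M i' j := by
  rw [Matrix.mul_apply, Finset.sum_eq_single i']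
  · simp [superdiagonal, hi]
  · intro l _ hl
    have : (l : ℕ) ≠ i + 1 := fun h => hl (Fin.ext (h.trans hi.symm))
    simp [superdiagonal, this]
  · simp

theorem superdiagonal_mul_superdiagonal {a b : ℕ → R} (h : ∀ m, a m * b (m + 1) = 0) :
    superdiagonal n a * superdiagonal n b = 0 := by
  ext i j
  rw [Matrix.mul_apply]
  refine Finset.sum_eq_zero fun l _ => ?_
  by_cases hl : (l : ℕ) = i + 1
  · simp [superdiagonal, hl, h]
  · simp [superdiagonal, hl]

theorem one_add_superdiagonal_mem_unitriangular (a : ℕ → R) :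
    1 + superdiagonal n a ∈ unitriangular (Fin n) R := by
  refine ⟨Matrix.blockTriangular_one.add fun i j hij => if_neg ?_, fun i => ?_⟩
  · have : (j : ℕ) < i := hij
    omega
  · simp [superdiagonal]

theorem prod_one_add_superdiagonal_apply {k : ℕ} (a : Fin k → ℕ → R) (i j : Fin n) :
    (i + k < (j : ℕ) →
      (List.ofFn fun m => 1 + superdiagonal n (a m) : List (Matrix _ _ R)).prod i j = 0) ∧
    (i + k = (j : ℕ) →
      (List.ofFn fun m => 1 + superdiagonal n (a m) : List (Matrix _ _ R)).prod i j =
        ∏ m, a m (i + m)) := by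
  induction k generalizing i with
  | zero =>
    refine ⟨fun h => Matrix.one_apply_ne fun hij => ?_, fun h => ?_⟩
    · simp [hij] at h
    · simp [Fin.ext h]
  | succ k ih =>
    have succ_apply (i' : Fin n) (hi : (i' : ℕ) = i + 1) :
        (List.ofFn fun m => 1 + superdiagonal n (a m) : List (Matrix _ _ R)).prod i j =
          (List.ofFn fun m => 1 + superdiagonal n (a m.succ) : List (Matrix _ _ R)).prod i j +
            a 0 i * (List.ofFn fun m => 1 + superdiagonal n (a m.succ) :
              List (Matrix _ _ R)).prod i' j := by
      rw [List.ofFn_succ, List.prod_cons, add_mul, one_mul, Matrix.add_apply,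
        superdiagonal_mul_apply _ _ hi]
    constructor <;> intro h <;>
      rw [succ_apply ⟨i + 1, by omega⟩ rfl, (ih _ i).1 (by omega), zero_add]
    · rw [(ih _ _).1 (by simp only; omega), mul_zero]
    · rw [(ih _ _).2 (by simp only; omega), Fin.prod_univ_succ]
      simp [add_assoc, add_comm 1]

/-- Characters into the additive group of `R`, placed on the superdiagonal. Consecutive characters
may not both be nontrivial, so that the superdiagonal matrices multiply to zero. -/
def superdiagonalHom {G : Type*} [Group G] (n : ℕ) (χ : ℕ → G →* Multiplicative R)
    (hχ : ∀ m, χ m = 1 ∨ χ (m + 1) = 1) : G →* unitriangular (Fin n) R where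
  toFun g := ⟨1 + superdiagonal n fun m => (χ m g).toAdd, one_add_superdiagonal_mem_unitriangular _⟩
  map_one' := Subtype.ext <| by
    ext
    simp [superdiagonal]
  map_mul' g h := Subtype.ext <| by
    have hadd : (fun m => (χ m (g * h)).toAdd) =
        (fun m => (χ m g).toAdd) + fun m => (χ m h).toAdd := by
      ext m
      simp
    have hmul : superdiagonal n (fun m => (χ m g).toAdd) *
        superdiagonal n (fun m => (χ m h).toAdd) = 0 :=
      superdiagonal_mul_superdiagonal fun m => by rcases hχ m with h | h <;> simp [h]
    simp only [hadd, superdiagonal_add, Submonoid.coe_mul, add_mul, mul_add, one_mul, mul_one, hmul]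
    abel

end Superdiagonal

section FreeProduct

variable {ι : Type*} {G : ι → Type*} [∀ i, Group (G i)]

theorem exists_characters_of_word {A : Type*} [CommGroup A]
    (hG : ∀ i (g : G i), g ≠ 1 → ∃ χ : G i →* A, χ g ≠ 1) (w : CoprodI.Word G) :
    ∃ χ : ℕ → ∀ i, G i →* A, (∀ m i, χ m i = 1 ∨ χ (m + 1) i = 1) ∧
      ∀ (m : ℕ) (hm : m < w.toList.length), χ m w.toList[m].1 w.toList[m].2 ≠ 1 := by
  classical
  have exists_character (m : ℕ) : ∃ χ : ∀ i, G i →* A,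
      (∀ i, χ i ≠ 1 → ∃ hm : m < w.toList.length, w.toList[m].1 = i) ∧
        ∀ hm : m < w.toList.length, χ w.toList[m].1 w.toList[m].2 ≠ 1 := by
    by_cases hm : m < w.toList.length
    · obtain ⟨χ, hχ⟩ := hG _ _ (w.ne_one _ (List.getElem_mem hm))
      refine ⟨Pi.mulSingle _ χ, fun i hi => ⟨hm, ?_⟩, fun _ => by rwa [Pi.mulSingle_eq_same]⟩
      by_contra hne
      exact hi (Pi.mulSingle_eq_of_ne (M := fun i => G i →* A) (Ne.symm hne) χ)
    · exact ⟨1, fun i hi => absurd rfl hi, fun h => absurd h hm⟩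
  choose χ hsupp hχ using exists_character
  refine ⟨χ, fun m i => ?_, hχ⟩
  by_contra! h
  obtain ⟨_, hi⟩ := hsupp m i h.1
  obtain ⟨hm, hi'⟩ := hsupp (m + 1) i h.2
  exact List.isChain_iff_getElem.1 w.chain_ne m hm (hi.trans hi'.symm)

theorem lift_superdiagonalHom_word_apply {R : Type*} [CommRing R] {w : CoprodI.Word G}
    (χ : ℕ → ∀ i, G i →* Multiplicative R) (hχ : ∀ m i, χ m i = 1 ∨ χ (m + 1) i = 1) :
    (CoprodI.lift (fun i => superdiagonalHom (w.toList.length + 1) (χ · i) (hχ · i)) w.prod).1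
        0 (Fin.last _) =
      ∏ m : Fin w.toList.length, (χ m w.toList[m].1 w.toList[m].2).toAdd := by
  have word_prod : w.prod =
      (List.ofFn fun m : Fin w.toList.length => CoprodI.of w.toList[m].2).prod := by
    conv_lhs => rw [CoprodI.Word.prod, ← List.ofFn_getElem (xs := w.toList), List.map_ofFn]
    rfl
  rw [word_prod, map_list_prod, ← Submonoid.coe_subtype, map_list_prod, List.map_ofFn,
    List.map_ofFn]
  simpa [Function.comp_def, superdiagonalHom] using
    (prod_one_add_superdiagonal_apply (fun (m : Fin w.toList.length) l =>
      (χ l w.toList[m].1 w.toList[m].2).toAdd) 0 (Fin.last _)).2 (by simp)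

theorem isResiduallyPFinite_coprodI {p : ℕ} [Fact p.Prime]
    (hG : ∀ i (g : G i), g ≠ 1 → ∃ χ : G i →* Multiplicative (ZMod p), χ g ≠ 1) :
    IsResiduallyPFinite p (CoprodI G) := by
  classical
  intro x hx
  obtain ⟨w, rfl⟩ : ∃ w : CoprodI.Word G, w.prod = x := CoprodI.Word.equiv.symm.surjective x
  obtain ⟨χ, hχ, hχw⟩ := exists_characters_of_word hG w
  set Φ := CoprodI.lift fun i => superdiagonalHom (w.toList.length + 1) (χ · i) (hχ · i)
  have corner_ne_zero : (Φ w.prod).1 0 (Fin.last _) ≠ 0 := by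
    rw [lift_superdiagonalHom_word_apply]
    exact Finset.prod_ne_zero_iff.2 fun m _ => hχw m m.2
  have hlength : w.toList.length ≠ 0 := fun h =>
    hx (by simp [CoprodI.Word.prod, List.length_eq_zero_iff.1 h])
  refine exists_surjective_ne_one_of_hom (isPGroup_units_unitriangular p) Φ.toHomUnits fun h => ?_
  have hΦ : Φ w.prod = 1 := congrArg Units.val h
  refine corner_ne_zero ?_
  rw [hΦ]
  exact Matrix.one_apply_ne (by simpa [Fin.ext_iff] using hlength.symm)

end FreeProduct

section Amalgam

variable {ι N : Type*} {G : ι → Type*} [Group N] [∀ i, Group (G i)]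

theorem base_coprodI_lift_apply {φ : ∀ i, G i →* MulAut N} (g : CoprodI G) (x : N) :
    PushoutI.base (fun i => (SemidirectProduct.inl : N →* N ⋊[φ i] G i)) (CoprodI.lift φ g x) =
      MulAut.conj (CoprodI.lift (fun i => (PushoutI.of i).comp SemidirectProduct.inr) g)
        (PushoutI.base _ x) := by
  induction g using CoprodI.induction_on generalizing x with
  | one => simp
  | of i g =>
    simp only [← PushoutI.of_apply_eq_base _ i, CoprodI.lift_of, SemidirectProduct.inl_aut,
      map_mul, map_inv, MonoidHom.comp_apply, MulAut.conj_apply]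
  | mul g h ihg ihh => simp only [map_mul, MulAut.mul_apply, ihg, ihh]

/-- The free product of split extensions of `N`, amalgamated along `N`, is the split extension of
`N` by the free product of the complements. -/
noncomputable def pushoutISemidirectProductEquiv (φ : ∀ i, G i →* MulAut N) :
    PushoutI (fun i => (SemidirectProduct.inl : N →* N ⋊[φ i] G i)) ≃*
      N ⋊[CoprodI.lift φ] CoprodI G :=
  MonoidHom.toMulEquiv
    (PushoutI.lift
      (fun i => SemidirectProduct.map (MonoidHom.id N) CoprodI.of fun g => by ext; simp)
      SemidirectProduct.inl fun i => by simp)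
    (SemidirectProduct.lift (PushoutI.base _)
      (CoprodI.lift fun i => (PushoutI.of i).comp SemidirectProduct.inr)
      fun g => MonoidHom.ext (base_coprodI_lift_apply g))
    (PushoutI.hom_ext
      (fun i => SemidirectProduct.hom_ext
        (by ext; simp [PushoutI.of_apply_eq_base]) (by ext; simp))
      (by ext; simp))
    (SemidirectProduct.hom_ext (by ext <;> simp) (by ext <;> simp))

end Amalgam

section TreeRotations

variable {p : ℕ}

/-- A permutation of `ℤ` acts on the `p`-ary tree of residue classes modulo the powers of `p`
through a rotation of the children at each vertex: the residue class of `i` modulo `p ^ k`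
determines the displacement `σ i - i` modulo `p ^ (k + 1)`. -/
def IsTreeRotation (p : ℕ) (σ : Equiv.Perm ℤ) : Prop :=
  ∀ (k : ℕ) (i j : ℤ), i ≡ j [ZMOD p ^ k] → σ i - i ≡ σ j - j [ZMOD p ^ (k + 1)]

theorem IsTreeRotation.modEq_iff {σ : Equiv.Perm ℤ} (hσ : IsTreeRotation p σ) {k : ℕ} {i j : ℤ} :
    σ i ≡ σ j [ZMOD p ^ k] ↔ i ≡ j [ZMOD p ^ k] := by
  refine ⟨fun h => ?_, fun h => ?_⟩
  · induction k with
    | zero => simp [Int.modEq_one]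
    | succ k ih =>
      have hij := ih (h.of_dvd (pow_dvd_pow _ k.le_succ))
      simpa using h.sub (hσ k i j hij)
  · simpa using ((hσ k i j h).of_dvd (pow_dvd_pow _ k.le_succ)).add h

/-- The group of tree rotations: the permutations of `ℤ` that act on the tree of residue classes
through the inverse limit of the iterated wreath products of cyclic groups of order `p`. -/
def treeRotationGroup (p : ℕ) : Subgroup (Equiv.Perm ℤ) where
  carrier := {σ | IsTreeRotation p σ}
  one_mem' k i j _ := by simp
  mul_mem' {σ τ} hσ hτ k i j h := by
    simpa using (hσ k _ _ (hτ.modEq_iff.2 h)).add (hτ k i j h)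
  inv_mem' {σ} hσ k i j h := by
    have hinv : σ⁻¹ i ≡ σ⁻¹ j [ZMOD p ^ k] := hσ.modEq_iff.1 (by simpa using h)
    simpa using (hσ k _ _ hinv).neg

theorem IsTreeRotation.pow_apply_modEq {σ : Equiv.Perm ℤ} (hσ : IsTreeRotation p σ) {k : ℕ} {i : ℤ}
    (hi : σ i ≡ i [ZMOD p ^ k]) (m : ℕ) :
    (σ ^ m) i ≡ i + m * (σ i - i) [ZMOD p ^ (k + 1)] := by
  induction m with
  | zero => simp
  | succ m ih =>
    have orbit_modEq : (σ ^ m) i ≡ i [ZMOD p ^ k] := by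
      refine (ih.of_dvd (pow_dvd_pow _ k.le_succ)).trans ?_
      simpa using (hi.symm.dvd.mul_left (m : ℤ)).modEq_zero_int.add_left i
    rw [pow_succ' σ, Equiv.Perm.mul_apply]
    convert (hσ k _ _ orbit_modEq).add ih using 1 <;> push_cast <;> ring

theorem IsTreeRotation.pow_pow_apply_modEq {σ : Equiv.Perm ℤ} (hσ : IsTreeRotation p σ) (k : ℕ)
    (i : ℤ) : (σ ^ p ^ k) i ≡ i [ZMOD p ^ k] := by
  induction k with
  | zero => simp [Int.modEq_one]
  | succ k ih =>
    have hpow : IsTreeRotation p (σ ^ p ^ k) := (treeRotationGroup p).pow_mem hσ _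
    have hdvd : (p : ℤ) ^ (k + 1) ∣ p * ((σ ^ p ^ k) i - i) :=
      pow_succ' (p : ℤ) k ▸ mul_dvd_mul_left _ ih.symm.dvd
    rw [pow_succ p, pow_mul σ]
    simpa using (hpow.pow_apply_modEq ih p).trans (hdvd.modEq_zero_int.add_left i)

theorem IsTreeRotation.intCast_apply_eq_iff {σ : Equiv.Perm ℤ} (hσ : IsTreeRotation p σ) {n : ℕ}
    {i j : ℤ} : ((σ i : ℤ) : ZMod (p ^ n)) = σ j ↔ (i : ZMod (p ^ n)) = j := by
  simp only [ZMod.intCast_eq_intCast_iff, Nat.cast_pow, hσ.modEq_iff]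

/-- The action of the tree rotations on the `n`-th level of the tree. -/
def reductionHom (p n : ℕ) : treeRotationGroup p →* Equiv.Perm (ZMod (p ^ n)) :=
  MonoidHom.toHomPerm
    { toFun := fun σ x => ((σ.1 x.cast : ℤ) : ZMod (p ^ n))
      map_one' := funext fun x => ZMod.intCast_zmod_cast x
      map_mul' := fun σ _ => funext fun _ =>
        σ.2.intCast_apply_eq_iff.2 (ZMod.intCast_zmod_cast _).symm }

theorem reductionHom_intCast (n : ℕ) (σ : treeRotationGroup p) (i : ℤ) :
    reductionHom p n σ i = (σ.1 i : ℤ) :=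
  σ.2.intCast_apply_eq_iff.2 (ZMod.intCast_zmod_cast _)

theorem isPGroup_range_reductionHom (p n : ℕ) : IsPGroup p (reductionHom p n).range := by
  rintro ⟨_, σ, rfl⟩
  refine ⟨n, Subtype.ext ?_⟩
  change reductionHom p n σ ^ p ^ n = 1
  ext x
  obtain ⟨i, rfl⟩ := ZMod.intCast_surjective x
  rw [← map_pow, reductionHom_intCast]
  simpa [ZMod.intCast_eq_intCast_iff] using σ.2.pow_pow_apply_modEq n i

end TreeRotations

section PermutationalSplitExtensions

/-- The action of the permutations of `X` on the finitely supported functions from `X` to `A`,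
written multiplicatively; for `X = ℤ` and `A = ZMod p` this is `permAut p`. -/
noncomputable def finsuppAut (X A : Type*) [AddCommMonoid A] :
    Equiv.Perm X →* MulAut (Multiplicative (X →₀ A)) where
  toFun π := AddEquiv.toMultiplicative (Finsupp.domCongr π)
  map_one' := by ext; rfl
  map_mul' _ _ := by ext; rfl

theorem finsuppAut_injective (X A : Type*) [AddCommMonoid A] [Nontrivial A] :
    Function.Injective (finsuppAut X A) := fun π ρ h => Equiv.ext fun x => by
  obtain ⟨a, ha⟩ := exists_ne (0 : A)
  have hsingle := DFunLike.congr_fun h (Multiplicative.ofAdd (Finsupp.single x a))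
  refine Finsupp.single_left_injective ha (Multiplicative.ofAdd.injective ?_)
  simpa [finsuppAut] using hsingle

theorem mapDomain_comp_finsuppAut {X Y A : Type*} [AddCommMonoid A] {f : X → Y} {π : Equiv.Perm X}
    {ρ : Equiv.Perm Y} (h : ∀ x, f (π x) = ρ (f x)) :
    (AddMonoidHom.toMultiplicative (Finsupp.mapDomain.addMonoidHom (M := A) f)).comp
        (finsuppAut X A π).toMonoidHom =
      (finsuppAut Y A ρ).toMonoidHom.comp
        (AddMonoidHom.toMultiplicative (Finsupp.mapDomain.addMonoidHom f)) := by
  ext x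
  simp [finsuppAut, h]

theorem exists_injOn_intCast {p : ℕ} (hp : 1 < p) (S : Finset ℤ) :
    ∃ n, Set.InjOn (Int.cast : ℤ → ZMod (p ^ n)) S := by
  have injOn_pair (i j : ℤ) : ∀ᶠ n in Filter.atTop, (i : ZMod (p ^ n)) = j → i = j := by
    filter_upwards [(tendsto_pow_atTop_atTop_of_one_lt hp).eventually_gt_atTop (j - i).natAbs]
      with n hn hij
    have hdvd := (ZMod.intCast_eq_intCast_iff_dvd_sub _ _ _).1 hij
    have := Int.eq_zero_of_dvd_of_natAbs_lt_natAbs hdvd hn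
    omega
  have injOn_S : ∀ᶠ n in Filter.atTop, ∀ i ∈ S, ∀ j ∈ S, (i : ZMod (p ^ n)) = j → i = j := by
    simp only [Filter.eventually_all_finset, injOn_pair, implies_true]
  obtain ⟨n, hn⟩ := injOn_S.exists
  exact ⟨n, fun i hi j hj => hn i hi j hj⟩

theorem exists_mapDomain_intCast_ne_zero {p : ℕ} (hp : 1 < p) {A : Type*} [AddCommMonoid A]
    {x : ℤ →₀ A} (hx : x ≠ 0) : ∃ n, x.mapDomain (Int.cast : ℤ → ZMod (p ^ n)) ≠ 0 := by
  obtain ⟨n, hn⟩ := exists_injOn_intCast hp x.support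
  refine ⟨n, fun h => hx (Finsupp.mapDomain_injOn _ hn ?_ ?_ (h.trans Finsupp.mapDomain_zero.symm))⟩
  · exact subset_rfl (a := (x.support : Set ℤ))
  · simp

theorem isResiduallyPFinite_finsupp_semidirectProduct {p : ℕ} [Fact p.Prime] {A G : Type*}
    [AddCommGroup A] [Module (ZMod p) A] [Finite A] [Group G] (hG : IsResiduallyPFinite p G)
    (ψ : G →* treeRotationGroup p) :
    IsResiduallyPFinite p (Multiplicative (ℤ →₀ A)
      ⋊[(finsuppAut ℤ A).comp ((treeRotationGroup p).subtype.comp ψ)] G) := by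
  refine hG.semidirectProduct fun x hx => ?_
  obtain ⟨n, hn⟩ := exists_mapDomain_intCast_ne_zero (Fact.out : p.Prime).one_lt
    (mt toAdd_eq_zero.1 hx)
  have : Finite (Multiplicative (ZMod (p ^ n) →₀ A)) :=
    .of_equiv (ZMod (p ^ n) → A) (Finsupp.equivFunOnFinite.symm.trans Multiplicative.ofAdd)
  refine ⟨Multiplicative (ZMod (p ^ n) →₀ A)
      ⋊[(finsuppAut _ A).comp (reductionHom p n).range.subtype] (reductionHom p n).range,
    inferInstance,
    SemidirectProduct.map
      (AddMonoidHom.toMultiplicative (Finsupp.mapDomain.addMonoidHom Int.cast))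
      ((reductionHom p n).rangeRestrict.comp ψ)
      fun g => mapDomain_comp_finsuppAut fun i => (reductionHom_intCast n (ψ g) i).symm,
    Finite.of_equiv _ SemidirectProduct.equivProd.symm,
    isPGroup_semidirectProduct ZModModule.isPGroup_multiplicative
      (isPGroup_range_reductionHom p n), ?_⟩
  rw [SemidirectProduct.map_inl, map_ne_one_iff _ SemidirectProduct.inl_injective]
  exact mt ofAdd_eq_one.1 hn

end PermutationalSplitExtensions

section CyclicComplements

theorem exists_comp_eq_of_range_le {G K M : Type*} [Group G] [Group K] [Group M] {f : K →* M}
    (hf : Function.Injective f) {φ : G →* M} (h : φ.range ≤ f.range) :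
    ∃ ψ : G →* K, f.comp ψ = φ := by
  refine ⟨(MonoidHom.ofInjective hf).symm.toMonoidHom.comp
    ((Subgroup.inclusion h).comp φ.rangeRestrict), MonoidHom.ext fun g => ?_⟩
  exact congrArg Subtype.val
    ((MonoidHom.ofInjective hf).apply_symm_apply (Subgroup.inclusion h (φ.rangeRestrict g)))

theorem exists_character_ne_one_of_card_eq {p : ℕ} [Fact p.Prime] {G : Type*} [Group G]
    (hG : Nat.card G = p) {g : G} (hg : g ≠ 1) : ∃ χ : G →* Multiplicative (ZMod p), χ g ≠ 1 := by
  have e : G ≃* Multiplicative (ZMod p) :=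
    mulEquivOfPrimeCardEq hG (by simp)
  exact ⟨e.toMonoidHom, (map_ne_one_iff e e.injective).2 hg⟩

theorem isResiduallyPFinite_pushoutI_splitExt {p : ℕ} [Fact p.Prime] {ι A : Type*}
    [AddCommGroup A] [Module (ZMod p) A] [Finite A] [Nontrivial A]
    {γ : ι → MulAut (Multiplicative (ℤ →₀ A))}
    (hγ : ∀ i, ∃ σ ∈ treeRotationGroup p, orderOf σ = p ∧ finsuppAut ℤ A σ = γ i) :
    IsResiduallyPFinite p (PushoutI fun i =>
      (SemidirectProduct.inl : Multiplicative (ℤ →₀ A) →* SplitExt (γ i))) := by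
  have card_zpowers (i : ι) : Nat.card (Subgroup.zpowers (γ i)) = p := by
    obtain ⟨σ, -, hσ, hi⟩ := hγ i
    rw [Nat.card_zpowers, ← hi, orderOf_injective _ (finsuppAut_injective ℤ A), hσ]
  have action_injective :
      Function.Injective ((finsuppAut ℤ A).comp (treeRotationGroup p).subtype) :=
    (finsuppAut_injective ℤ A).comp (treeRotationGroup p).subtype_injective
  have range_le : (CoprodI.lift fun i => (Subgroup.zpowers (γ i)).subtype).range ≤
      ((finsuppAut ℤ A).comp (treeRotationGroup p).subtype).range := by
    refine CoprodI.lift_range_le _ _ fun i => ?_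
    obtain ⟨σ, hσ, -, hi⟩ := hγ i
    rw [Subgroup.range_subtype, Subgroup.zpowers_le]
    exact ⟨⟨σ, hσ⟩, hi⟩
  obtain ⟨ψ, hψ⟩ := exists_comp_eq_of_range_le action_injective range_le
  have residuallyPFinite_coprodI :
      IsResiduallyPFinite p (CoprodI fun i => Subgroup.zpowers (γ i)) :=
    isResiduallyPFinite_coprodI fun i _ => exists_character_ne_one_of_card_eq (card_zpowers i)
  have residuallyPFinite_splitExt :=
    isResiduallyPFinite_finsupp_semidirectProduct (A := A) residuallyPFinite_coprodI ψ
  rw [← MonoidHom.comp_assoc, hψ] at residuallyPFinite_splitExt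
  exact residuallyPFinite_splitExt.of_injective
    (pushoutISemidirectProductEquiv fun i => (Subgroup.zpowers (γ i)).subtype).injective

end CyclicComplements

section BlockRotation

variable {p : ℕ}

theorem mu_apply_sub_self (p : ℕ) (i : ℤ) :
    mu p i - i = if (p : ℤ) ∣ i + 1 then 1 - (p : ℤ) else 1 := by
  have modEq_iff_dvd : i ≡ p - 1 [ZMOD p] ↔ (p : ℤ) ∣ i + 1 := by
    rw [Int.modEq_comm, Int.modEq_iff_dvd, show i - (p - 1) = i + 1 - p by ring, dvd_sub_self_right]
  simp only [mu, Equiv.coe_fn_mk, modEq_iff_dvd]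
  split_ifs <;> ring

theorem mu_mem_treeRotationGroup (p : ℕ) : mu p ∈ treeRotationGroup p := by
  intro k i j h
  rw [mu_apply_sub_self, mu_apply_sub_self]
  cases k with
  | zero => split_ifs <;> simp [Int.modEq_iff_dvd]
  | succ k =>
    have hdvd : (p : ℤ) ∣ i + 1 ↔ (p : ℤ) ∣ j + 1 :=
      ((h.of_dvd (dvd_pow_self _ k.succ_ne_zero)).add_right 1).dvd_iff
    rw [if_congr hdvd rfl rfl]

theorem lam_mem_treeRotationGroup (p : ℕ) : lam ∈ treeRotationGroup p := fun k i j _ => by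
  simp [lam]

theorem nu_eq_conj (p : ℕ) : nu p = MulAut.conj lam (mu p) := rfl

theorem nu_mem_treeRotationGroup (p : ℕ) : nu p ∈ treeRotationGroup p :=
  mul_mem (lam_mem_treeRotationGroup p)
    (mul_mem (mu_mem_treeRotationGroup p) (inv_mem (lam_mem_treeRotationGroup p)))

theorem mu_apply_ediv (hp : 0 < p) (i : ℤ) : mu p i / p = i / p := by
  have hp' : (0 : ℤ) < p := by exact_mod_cast hp
  have hdecomp := Int.emod_add_mul_ediv i p
  have hnonneg := Int.emod_nonneg i hp'.ne'
  have hlt := Int.emod_lt_of_pos i hp'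
  have dvd_iff_last : (p : ℤ) ∣ i + 1 ↔ i % p + 1 = p := by
    refine ⟨fun h => ?_, fun h => ⟨i / p + 1, by linarith⟩⟩
    have := Int.le_of_dvd (by linarith) (dvd_sub h (dvd_mul_right (p : ℤ) (i / p)))
    linarith
  have hmu := mu_apply_sub_self p i
  rw [Int.ediv_eq_iff_of_pos hp']
  split_ifs at hmu with hlast
  · rw [dvd_iff_last] at hlast
    constructor <;> linarith
  · rw [dvd_iff_last] at hlast
    have : i % p + 1 < p := by omega
    constructor <;> linarith

theorem mu_pow_self (hp : 0 < p) : mu p ^ p = 1 := by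
  ext i
  have pow_apply_ediv (m : ℕ) : (mu p ^ m) i / p = i / p := by
    induction m with
    | zero => rfl
    | succ m ih => rw [pow_succ', Equiv.Perm.mul_apply, mu_apply_ediv hp, ih]
  have pow_apply_emod : (mu p ^ p) i % p = i % p := by
    simpa [Int.ModEq] using (mu_mem_treeRotationGroup p).pow_pow_apply_modEq 1 i
  rw [← Int.mul_ediv_add_emod ((mu p ^ p) i) p, pow_apply_ediv, pow_apply_emod,
    Int.mul_ediv_add_emod, Equiv.Perm.one_apply]

theorem orderOf_mu [Fact p.Prime] : orderOf (mu p) = p := by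
  refine orderOf_eq_prime (mu_pow_self (Fact.out : p.Prime).pos) fun h => ?_
  have hp : (1 : ℤ) < p := by exact_mod_cast (Fact.out : p.Prime).one_lt
  have hzero := mu_apply_sub_self p 0
  rw [h, Equiv.Perm.one_apply, sub_self] at hzero
  split_ifs at hzero <;> omega

theorem orderOf_nu [Fact p.Prime] : orderOf (nu p) = p := by
  rw [nu_eq_conj, MulEquiv.orderOf_eq, orderOf_mu]

theorem nu_mul_mu_inv_apply (hp : 1 < p) {i : ℤ} (hi : (p : ℤ) ∣ i) :
    (nu p * (mu p)⁻¹) i = i + p := by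
  have mu_inv_apply : (mu p)⁻¹ i = i + p - 1 := by
    have := mu_apply_sub_self p (i + p - 1)
    rw [sub_add_cancel, if_pos (hi.add dvd_rfl)] at this
    rw [Equiv.Perm.inv_eq_iff_eq]
    linarith
  have not_dvd : ¬ (p : ℤ) ∣ i + p - 2 + 1 := fun h => by
    have := Int.le_of_dvd (by omega) (dvd_sub (hi.add (dvd_refl (p : ℤ))) h)
    omega
  have := mu_apply_sub_self p (i + p - 2)
  rw [if_neg not_dvd] at this
  rw [Equiv.Perm.mul_apply, mu_inv_apply]
  change mu p (i + p - 1 - 1) + 1 = i + p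
  rw [show i + p - 1 - 1 = i + p - 2 by ring]
  linarith

theorem not_isOfFinOrder_nu_mul_mu_inv (hp : 1 < p) : ¬ IsOfFinOrder (nu p * (mu p)⁻¹) := by
  have pow_apply_zero (m : ℕ) : ((nu p * (mu p)⁻¹) ^ m) 0 = m * p := by
    induction m with
    | zero => simp
    | succ m ih =>
      rw [pow_succ', Equiv.Perm.mul_apply, ih, nu_mul_mu_inv_apply hp (dvd_mul_left _ _)]
      push_cast
      ring
  refine not_isOfFinOrder_of_injective_pow fun m n h => ?_
  have h0 := DFunLike.congr_fun h 0
  simp only [pow_apply_zero] at h0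
  exact_mod_cast mul_right_cancel₀ (by exact_mod_cast (by omega : p ≠ 0)) h0

end BlockRotation

end AmalgP

theorem proposition4p3 (p : ℕ) (hp : p.Prime) :
    AmalgP.IsResiduallyPFinite p (AmalgP.P p) ∧
      ¬ IsOfFinOrder (G := MulAut (AmalgP.H p))
        ((AmalgP.alpha p).symm.trans (AmalgP.beta p)) := by
  have : Fact p.Prime := ⟨hp⟩
  constructor
  · refine AmalgP.isResiduallyPFinite_pushoutI_splitExt fun b => ?_
    cases b
    · exact ⟨AmalgP.mu p, AmalgP.mu_mem_treeRotationGroup p, AmalgP.orderOf_mu, rfl⟩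
    · exact ⟨AmalgP.nu p, AmalgP.nu_mem_treeRotationGroup p, AmalgP.orderOf_nu, rfl⟩
  · have action_eq : (AmalgP.alpha p).symm.trans (AmalgP.beta p) =
        AmalgP.finsuppAut ℤ (ZMod p) (AmalgP.nu p * (AmalgP.mu p)⁻¹) := by
      ext; rfl
    rw [action_eq, (AmalgP.finsuppAut_injective ℤ (ZMod p)).isOfFinOrder_iff]
    exact AmalgP.not_isOfFinOrder_nu_mul_mu_inv hp.one_lt
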